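/- Let $\mathbb{F}$ be a division ring, $n \ge 1$ an integer, $\sigma : \mathbb{F} \to \mathbb{F}^{n\times n}$ a (unital) ring morphism, $\delta : \mathbb{F} \to \mathbb{F}^n$ a $\sigma$-derivation (an additive map with $\delta(bc) = \sigma(b)\delta(c) + \delta(b)c$ for all $b, c \in \mathbb{F}$), and $\mathbf{a} \in \mathbb{F}^n$. Put $\mathcal{D}_\mathbf{a}(\beta) = \sigma(\beta)\mathbf{a} + \delta(\beta) \in \mathbb{F}^n$ for $\beta \in \mathbb{F}$, and let $K = K_\mathbf{a} = \{\beta \in \mathbb{F} \mid \mathcal{D}_\mathbf{a}(\beta) = \mathbf{a}\beta\}$, a division subring of $\mathbb{F}$; the pair $K \subseteq \mathbb{F}$ is called a P-Galois extension, and it is called finite if the right dimension $\dim^R_K(\mathbb{F})$ is finite. Let $\mathcal{M}$ be the free monoid on $x_1, \ldots, x_n$, and define operators $\mathcal{D}_\mathbf{a}^{\mathfrak{m}} : \mathbb{F} \to \mathbb{F}$ for $\mathfrak{m} \in \mathcal{M}$ recursively by $\mathcal{D}_\mathbf{a}^{1} = \mathrm{Id}$ and $\mathcal{D}_\mathbf{a}^{x_i\mathfrak{m}}(\beta)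 = $ the $i$-th component of $\mathcal{D}_\mathbf{a}(\mathcal{D}_\mathbf{a}^{\mathfrak{m}}(\beta))$. Let $\mathcal{D}_\mathbf{a}^{\mathcal{M}} = \{\mathcal{D}_\mathbf{a}^{\mathfrak{m}} \mid \mathfrak{m} \in \mathcal{M}\}$, a set of maps $\mathbb{F} \to \mathbb{F}$, and let $\mathbb{F}[\mathcal{D}_\mathbf{a}]$ be the left $\mathbb{F}$-vector space of maps $\mathbb{F} \to \mathbb{F}$ spanned by $\mathcal{D}_\mathbf{a}^{\mathcal{M}}$. Then the P-Galois extension $K \subseteq \mathbb{F}$ is finite if, and only if, $\mathbb{F}[\mathcal{D}_\mathbf{a}]$ has finite left dimension over $\mathbb{F}$, in which case $\dim^L_{\mathbb{F}}(\mathbb{F}[\mathcal{D}_\mathbf{a}]) = \dim^R_{K}(\mathbb{F})$. Moreover, the elements of $\mathcal{D}_\mathbf{a}^{\mathcal{M}}$ are right $K$-linear maps, and if the set $\mathcal{D}_\mathbf{a}^{\mathcal{M}}$ is finite, then $K \subseteq \mathbb{F}$ is finite and $\dim^R_K(\mathbb{F}) \le |\mathcal{D}_\mathbf{a}^{\mathcal{M}}|$.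 -/

import Mathlib

/-! # Linearized multivariate skew polynomials and P-Galois extensions of division rings -/

namespace PGalois

open Matrix

/-- A `σ`-derivation `δ : F → Fⁿ` for a ring morphism `σ : F → Fⁿˣⁿ`: an additive map with
`δ (a b) = σ(a) δ(b) + δ(a) b`. -/
structure SkewDerivation {F : Type*} [DivisionRing F] {n : ℕ}
    (σ : F →+* Matrix (Fin n) (Fin n) F) extends F →+ (Fin n → F) where
  leibniz' : ∀ b c : F, toFun (b * c) = σ b *ᵥ toFun c + fun i => toFun b i * c

section

variable {F : Type*} [DivisionRing F] {n : ℕ} {σ : F →+* Matrix (Fin n) (Fin n) F}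

instance : CoeFun (SkewDerivation σ) (fun _ => F → (Fin n → F)) := ⟨fun δ => δ.toFun⟩

/-- The operator `D_a : F → Fⁿ`, `D_a(β) = σ(β) a + δ(β)`. -/
def vecOp (δ : SkewDerivation σ) (a : Fin n → F) (β : F) : Fin n → F :=
  σ β *ᵥ a + δ β

theorem vecOp_add (δ : SkewDerivation σ) (a : Fin n → F) (β γ : F) :
    vecOp δ a (β + γ) = vecOp δ a β + vecOp δ a γ := by
  have h : δ (β + γ) = δ β + δ γ := δ.map_add' β γ
  simp only [vecOp, map_add, Matrix.add_mulVec, h]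
  abel

theorem vecOp_zero (δ : SkewDerivation σ) (a : Fin n → F) : vecOp δ a 0 = 0 := by
  have h : δ 0 = 0 := δ.map_zero'
  simp [vecOp, h]

theorem vecOp_one (δ : SkewDerivation σ) (a : Fin n → F) : vecOp δ a 1 = a := by
  have h : δ 1 = 0 := by
    have h1 : δ (1 * 1) = σ 1 *ᵥ δ 1 + fun i => δ 1 i * 1 := δ.leibniz' 1 1
    simpa using h1
  simp [vecOp, h]

/-- The operators `D_a` commute with right multiplication by `γ` whenever `D_a(γ) = a γ`. -/
theorem vecOp_mul (δ : SkewDerivation σ) (a : Fin n → F) (β γ : F)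
    (hγ : vecOp δ a γ = fun i => a i * γ) :
    vecOp δ a (β * γ) = fun i => vecOp δ a β i * γ := by
  have h : δ (β * γ) = σ β *ᵥ δ γ + fun i => δ β i * γ := δ.leibniz' β γ
  have h2 : vecOp δ a (β * γ) = σ β *ᵥ vecOp δ a γ + fun i => δ β i * γ := by
    simp only [vecOp, h, map_mul, Matrix.mulVec_add, ← Matrix.mulVec_mulVec, add_assoc]
  rw [h2, hγ]
  funext i
  simp [vecOp, Matrix.mulVec, dotProduct, add_mul, Finset.sum_mul, mul_assoc]

/-- The centralizer `K_a = {β ∈ F | D_a(β) = a β}`, a division subring of `F`. -/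
def centralizer (δ : SkewDerivation σ) (a : Fin n → F) : Subfield F where
  carrier := {β | vecOp δ a β = fun i => a i * β}
  mul_mem' := by
    intro β γ hβ hγ
    simp only [Set.mem_ofPred_eq] at hβ hγ ⊢
    rw [vecOp_mul δ a β γ hγ, hβ]
    funext i
    simp [mul_assoc]
  one_mem' := by simp [vecOp_one]
  add_mem' := by
    intro β γ hβ hγ
    simp only [Set.mem_ofPred_eq] at hβ hγ ⊢
    rw [vecOp_add, hβ, hγ]
    funext i
    simp [mul_add]
  zero_mem' := by
    simp only [Set.mem_ofPred_eq, vecOp_zero, mul_zero]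
    rfl
  neg_mem' := by
    intro β hβ
    simp only [Set.mem_ofPred_eq] at hβ ⊢
    have h := vecOp_add δ a β (-β)
    rw [add_neg_cancel, vecOp_zero, hβ] at h
    rw [eq_neg_of_add_eq_zero_right h.symm]
    funext i
    simp
  inv_mem' := by
    intro β hβ
    simp only [Set.mem_ofPred_eq] at hβ ⊢
    by_cases h0 : β = 0
    · subst h0
      simpa using hβ
    · have h := vecOp_mul δ a β⁻¹ β hβ
      rw [inv_mul_cancel₀ h0, vecOp_one] at h
      funext i
      exact (eq_mul_inv_iff_mul_eq₀ h0).mpr (congrFun h i).symm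

/-- The operator `D_a^m : F → F` of a monomial `m` in the free monoid on `x₁, …, xₙ`:
`D_a^1 = Id`, and `D_a^(x_i m)` is the `i`-th component of `D_a ∘ D_a^m`. -/
def monOp (δ : SkewDerivation σ) (a : Fin n → F) (m : FreeMonoid (Fin n)) (β : F) : F :=
  m.toList.foldr (fun i γ => vecOp δ a γ i) β

theorem monOp_one (δ : SkewDerivation σ) (a : Fin n → F) : monOp δ a 1 = id := rfl

theorem monOp_of_mul (δ : SkewDerivation σ) (a : Fin n → F) (i : Fin n)
    (m : FreeMonoid (Fin n)) (β : F) :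
    monOp δ a (FreeMonoid.of i * m) β
      = (σ (monOp δ a m β) *ᵥ a + δ (monOp δ a m β)) i := rfl

/-- The set of operators `D_a^M = {D_a^m | m a monomial}`. -/
def monOps (δ : SkewDerivation σ) (a : Fin n → F) : Set (F → F) :=
  Set.range (monOp δ a)

/-- The left `F`-vector space `F[D_a]` of linearized polynomials: the left span of `D_a^M`
inside the maps `F → F`, where `(c • f)(β) = c * f(β)`. -/
def linPoly (δ : SkewDerivation σ) (a : Fin n → F) : Submodule F (F → F) :=
  Submodule.span F (monOps δ a)

/-- `K ⊆ F` is the P-Galois extension given by `n ≥ 1`, `σ`, `δ` and `a`: `K = K_a`. -/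
structure IsPGaloisExtension (K : Subfield F) (δ : SkewDerivation σ) (a : Fin n → F) :
    Prop where
  pos : 0 < n
  eq_centralizer : K = centralizer δ a

/-- The scalars acting on `F` from the right through `K`, as a subring of `Fᵐᵒᵖ`. An
`F`-module over this ring is a right `K`-vector space. -/
abbrev rightScalars (K : Subfield F) : Subring Fᵐᵒᵖ := K.toSubring.op

theorem rightScalars_smul (K : Subfield F) (c : F) (hc : c ∈ K) (β : F) :
    (⟨MulOpposite.op c, hc⟩ : rightScalars K) • β = β * c := rfl

/-- `K ⊆ F` is finite: `F` has finite right dimension over `K`. -/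
def IsFiniteExtension (K : Subfield F) : Prop := Module.Finite (rightScalars K) F

/-- The right dimension of `F` over `K` (used only when it is finite). -/
noncomputable def rightDim (K : Subfield F) : ℕ := Module.finrank (rightScalars K) F

end

end PGalois

/-! The set `F[D_a]` is closed under composition, so it is a ring of additive endomorphisms of `F`.
It contains all left multiplications, so `F` is a simple module over it, and its commutant consists
of the right multiplications by elements of `K`. By Jacobson's density theorem, evaluation of
`F[D_a]` at finitely many right `K`-independent points is onto; it is injective at the points of a
basis because the elements of `F[D_a]` are right `K`-linear. -/

namespace PGalois

open Matrix

section Density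

variable {R S M : Type*}

theorem exists_smul_eq_of_linearIndependent {A ι : Type*} [Ring A] [DivisionRing R]
    [AddCommGroup M] [Module A M] [Module R M] [IsSemisimpleModule A M] [Finite ι]
    (hEnd : ∀ φ : Module.End A M, ∃ c : R, ∀ x, φ x = c • x)
    {β : ι → M} (hβ : LinearIndependent R β) (v : ι → M) :
    ∃ T : A, ∀ i, T • β i = v i := by
  classical
  have := Fintype.ofFinite ι
  obtain ⟨coords, hcoords⟩ := (Finsupp.linearCombination R β).exists_leftInverse_of_injective
    (LinearMap.ker_eq_bot.mpr hβ)
  let g : M →ₗ[R] M := Finsupp.linearCombination R v ∘ₗ coords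
  have hg (i : ι) : g (β i) = v i := by
    have hcoord : coords (β i) = Finsupp.single i 1 := by
      simpa using LinearMap.congr_fun hcoords (Finsupp.single i 1)
    simp [g, hcoord]
  let bicommutant : Module.End (Module.End A M) M :=
    { toFun := g
      map_add' := g.map_add
      map_smul' := fun φ x => by
        obtain ⟨c, hc⟩ := hEnd φ
        simp only [Module.End.smul_def, hc, map_smul, RingHom.id_apply] }
  obtain ⟨T, hT⟩ := jacobson_density bicommutant (Finset.univ.image β)
  refine ⟨T, fun i => ?_⟩
  rw [← hT (β i) (Finset.mem_image_of_mem β (Finset.mem_univ i))]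
  exact hg i

theorem isLinearMap_of_mem_span [Semiring R] [Semiring S] [AddCommMonoid M] [Module R M]
    [Module R S] [SMulCommClass R S S] {s : Set (M → S)} (hs : ∀ f ∈ s, IsLinearMap R f)
    {f : M → S} (hf : f ∈ Submodule.span S s) : IsLinearMap R f := by
  have hspan : Submodule.span S s ≤ LinearMap.range (LinearMap.ltoFun R M S S) :=
    Submodule.span_le.mpr fun g hg => ⟨(hs g hg).mk' g, rfl⟩
  obtain ⟨φ, rfl⟩ := hspan hf
  exact φ.isLinear

/-- Evaluation of the functions of a left `S`-module `V` at a family of points. -/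
def evalOn {ι : Type*} [Semiring S] (V : Submodule S (M → S)) (β : ι → M) : V →ₗ[S] (ι → S) :=
  LinearMap.funLeft S S β ∘ₗ V.subtype

theorem evalOn_injective {ι : Type*} [Semiring R] [Semiring S] [AddCommMonoid M] [Module R M]
    [Module R S] {V : Submodule S (M → S)} (hV : ∀ f ∈ V, IsLinearMap R f)
    (b : Module.Basis ι R M) : Function.Injective (evalOn V b) := by
  intro f g hfg
  have heq : (hV f f.2).mk' _ = (hV g g.2).mk' _ := b.ext fun i => congrFun hfg i
  exact Subtype.ext (congrArg DFunLike.coe heq)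

/-- Density in the sense of Jacobson: `V` realizes every assignment of values to finitely many
`R`-linearly independent points. Families are indexed by `Fin k` to stay in one universe. -/
def IsDense (R : Type*) [Semiring R] [Semiring S] [AddCommMonoid M] [Module R M]
    (V : Submodule S (M → S)) : Prop :=
  ∀ (k : ℕ) (β : Fin k → M), LinearIndependent R β → Function.Surjective (evalOn V β)

variable [Semiring R] [StrongRankCondition R] [Semiring S] [AddCommMonoid M] [Module R M]
  [Module.Free R M] {V : Submodule S (M → S)}

/-- Evaluation at a basis, as an isomorphism from a dense space of linear functions. -/
noncomputable def IsDense.evalEquiv [Module R S] [Module.Finite R M] (hV : IsDense R V)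
    (hlin : ∀ f ∈ V, IsLinearMap R f) : V ≃ₗ[S] (Fin (Module.finrank R M) → S) :=
  let b := Module.finBasis R M
  LinearEquiv.ofBijective (evalOn V b) ⟨evalOn_injective hlin b, hV _ b b.linearIndependent⟩

theorem IsDense.finite_submodule [Module R S] [Module.Finite R M] (hV : IsDense R V)
    (hlin : ∀ f ∈ V, IsLinearMap R f) : Module.Finite S V :=
  Module.Finite.equiv (hV.evalEquiv hlin).symm

variable [StrongRankCondition S]

theorem IsDense.finrank_eq [Module R S] [Module.Finite R M] (hV : IsDense R V)
    (hlin : ∀ f ∈ V, IsLinearMap R f) : Module.finrank S V = Module.finrank R M := by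
  rw [(hV.evalEquiv hlin).finrank_eq, Module.finrank_fin_fun]

theorem IsDense.finite_domain [Module.Finite S V] (hV : IsDense R V) : Module.Finite R M := by
  have hrank : Module.rank R M ≤ Module.finrank S V := rank_le fun s hs => by
    simpa only [Module.finrank_fin_fun] using LinearMap.finrank_le_finrank_of_surjective
      (hV s.card _ (hs.comp _ s.equivFin.symm.injective))
  exact Module.rank_lt_aleph0_iff.mp (hrank.trans_lt Cardinal.natCast_lt_aleph0)

end Density

theorem finrank_span_le_ncard {R M : Type*} [Semiring R] [StrongRankCondition R] [AddCommMonoid M]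
    [Module R M] {s : Set M} (hs : s.Finite) :
    Module.finrank R (Submodule.span R s) ≤ s.ncard := by
  have := hs.fintype
  rw [Set.ncard_eq_toFinset_card']
  exact finrank_span_le_card s

theorem isSimpleModule_of_mulLeft_mem {F : Type*} [DivisionRing F]
    {A : Subring (AddMonoid.End F)} (hA : ∀ b, AddMonoidHom.mulLeft b ∈ A) :
    IsSimpleModule A F := by
  refine isSimpleModule_iff_toSpanSingleton_surjective.mpr
    ⟨inferInstance, fun x hx y => ⟨⟨_, hA (y * x⁻¹)⟩, ?_⟩⟩
  exact inv_mul_cancel_right₀ hx y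

theorem end_apply_eq_mul_apply_one {F : Type*} [Ring F] {A : Subring (AddMonoid.End F)}
    (hA : ∀ b, AddMonoidHom.mulLeft b ∈ A) (φ : Module.End A F) (x : F) :
    φ x = x * φ 1 := by
  have h : φ (x * 1) = x * φ 1 := φ.map_smul ⟨_, hA x⟩ 1
  rwa [mul_one] at h

/-- The right scalars of a division subring form a division ring. This is not an instance, since
instance search would then reach the ring structure of `rightScalars K` through it. -/
noncomputable abbrev rightScalarsDivisionRing {F : Type*} [DivisionRing F] (K : Subfield F) :
    DivisionRing (rightScalars K) :=
  DivisionRing.ofIsUnitOrEqZero fun c => by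
    refine or_iff_not_imp_right.mpr fun hc => ?_
    have hc' : c.1 ≠ 0 := fun h => hc (Subtype.ext h)
    exact ⟨⟨c, ⟨c.1⁻¹, K.inv_mem c.2⟩, Subtype.ext (mul_inv_cancel₀ hc'),
      Subtype.ext (inv_mul_cancel₀ hc')⟩, rfl⟩

section LinearizedPolynomials

variable {F : Type*} [DivisionRing F] {n : ℕ} {σ : F →+* Matrix (Fin n) (Fin n) F}
  (δ : SkewDerivation σ) (a : Fin n → F)

theorem vecOp_mul_eq_mulVec_add (b c : F) :
    vecOp δ a (b * c) = σ b *ᵥ vecOp δ a c + fun i => δ b i * c := by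
  have leibniz : δ (b * c) = σ b *ᵥ δ c + fun i => δ b i * c := δ.leibniz' b c
  simp only [vecOp, leibniz, map_mul, mulVec_add, ← mulVec_mulVec, add_assoc]

theorem isLinearMap_monOp (m : FreeMonoid (Fin n)) :
    IsLinearMap (rightScalars (centralizer δ a)) (monOp δ a m) := by
  induction m using FreeMonoid.inductionOn' with
  | one => exact LinearMap.id.isLinear
  | of_mul i m ih =>
    constructor
    · intro β γ
      change vecOp δ a (monOp δ a m (β + γ)) i = _
      rw [ih.map_add, vecOp_add]
      rfl
    · intro c β
      change vecOp δ a (monOp δ a m (c • β)) i = _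
      rw [ih.map_smul]
      exact congrFun (vecOp_mul δ a (monOp δ a m β) c.1.unop c.2) i

theorem isLinearMap_of_mem_monOps {f : F → F} (hf : f ∈ monOps δ a) :
    IsLinearMap (rightScalars (centralizer δ a)) f := by
  obtain ⟨m, rfl⟩ := hf
  exact isLinearMap_monOp δ a m

theorem isLinearMap_of_mem_linPoly {f : F → F} (hf : f ∈ linPoly δ a) :
    IsLinearMap (rightScalars (centralizer δ a)) f :=
  isLinearMap_of_mem_span (fun _ => isLinearMap_of_mem_monOps δ a) hf

theorem monOp_mem_linPoly (m : FreeMonoid (Fin n)) : monOp δ a m ∈ linPoly δ a :=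
  Submodule.subset_span ⟨m, rfl⟩

variable {δ a}

theorem vecOp_comp_mem_linPoly (i : Fin n) {f : F → F} (hf : f ∈ linPoly δ a) :
    (fun β => vecOp δ a (f β) i) ∈ linPoly δ a := by
  induction hf using Submodule.span_induction generalizing i with
  | mem f hf =>
    obtain ⟨m, rfl⟩ := hf
    exact monOp_mem_linPoly δ a (FreeMonoid.of i * m)
  | zero =>
    simp only [Pi.zero_apply, vecOp_zero]
    exact zero_mem _
  | add f g _ _ hf hg =>
    simp only [Pi.add_apply, vecOp_add]
    exact add_mem (hf i) (hg i)
  | smul b f hf ih =>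
    have hexpand : (fun β => vecOp δ a ((b • f) β) i) =
        ∑ j, σ b i j • (fun β => vecOp δ a (f β) j) + δ b i • f := by
      funext β
      simp [vecOp_mul_eq_mulVec_add, mulVec, dotProduct]
    rw [hexpand]
    exact add_mem (sum_mem fun j _ => Submodule.smul_mem _ _ (ih j)) (Submodule.smul_mem _ _ hf)

theorem comp_mem_linPoly {f g : F → F} (hf : f ∈ linPoly δ a) (hg : g ∈ linPoly δ a) :
    f ∘ g ∈ linPoly δ a := by
  induction hf using Submodule.span_induction with
  | mem f hf =>
    obtain ⟨m, rfl⟩ := hf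
    induction m using FreeMonoid.inductionOn' with
    | one => exact hg
    | of_mul i m ih => exact vecOp_comp_mem_linPoly i ih
  | zero => exact zero_mem _
  | add f₁ f₂ _ _ hf₁ hf₂ => exact add_mem hf₁ hf₂
  | smul b f _ hf => exact Submodule.smul_mem _ b hf

variable (δ a)

/-- The ring structure of `F[D_a]`: its elements, viewed as additive endomorphisms of `F`, with
composition as multiplication. -/
def linPolySubring : Subring (AddMonoid.End F) where
  carrier := {T | (T : F → F) ∈ linPoly δ a}
  mul_mem' := comp_mem_linPoly
  one_mem' := monOp_mem_linPoly δ a 1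
  add_mem' := (linPoly δ a).add_mem
  zero_mem' := (linPoly δ a).zero_mem
  neg_mem' := (linPoly δ a).neg_mem

theorem mulLeft_mem_linPolySubring (b : F) : AddMonoidHom.mulLeft b ∈ linPolySubring δ a :=
  Submodule.smul_mem _ b (monOp_mem_linPoly δ a 1)

theorem end_apply_one_mem_centralizer (φ : Module.End (linPolySubring δ a) F) :
    φ 1 ∈ centralizer δ a := by
  have hcomm (m : FreeMonoid (Fin n)) : φ (monOp δ a m 1) = monOp δ a m (φ 1) :=
    φ.map_smul ⟨AddMonoidHom.mk' _ (isLinearMap_monOp δ a m).map_add, monOp_mem_linPoly δ a m⟩ 1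
  funext i
  calc vecOp δ a (φ 1) i = φ (vecOp δ a 1 i) := (hcomm (FreeMonoid.of i)).symm
    _ = φ (a i) := by rw [vecOp_one]
    _ = a i * φ 1 := end_apply_eq_mul_apply_one (mulLeft_mem_linPolySubring δ a) φ (a i)

theorem isDense_linPoly : IsDense (rightScalars (centralizer δ a)) (linPoly δ a) := by
  intro k β hβ v
  let := rightScalarsDivisionRing (centralizer δ a)
  have := isSimpleModule_of_mulLeft_mem (mulLeft_mem_linPolySubring δ a)
  have hEnd (φ : Module.End (linPolySubring δ a) F) :
      ∃ c : rightScalars (centralizer δ a), ∀ x, φ x = c • x :=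
    ⟨⟨MulOpposite.op (φ 1), end_apply_one_mem_centralizer δ a φ⟩,
      end_apply_eq_mul_apply_one (mulLeft_mem_linPolySubring δ a) φ⟩
  obtain ⟨T, hT⟩ := exists_smul_eq_of_linearIndependent hEnd hβ v
  exact ⟨⟨T.1, T.2⟩, funext hT⟩

theorem isFiniteExtension_centralizer_iff :
    IsFiniteExtension (centralizer δ a) ↔ Module.Finite F (linPoly δ a) := by
  let := rightScalarsDivisionRing (centralizer δ a)
  constructor
  · intro (_ : Module.Finite (rightScalars (centralizer δ a)) F)
    exact (isDense_linPoly δ a).finite_submodule fun _ => isLinearMap_of_mem_linPoly δ a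
  · intro _
    exact (isDense_linPoly δ a).finite_domain

theorem finrank_linPoly (h : IsFiniteExtension (centralizer δ a)) :
    Module.finrank F (linPoly δ a) = rightDim (centralizer δ a) := by
  let := rightScalarsDivisionRing (centralizer δ a)
  have : Module.Finite (rightScalars (centralizer δ a)) F := h
  exact (isDense_linPoly δ a).finrank_eq fun _ => isLinearMap_of_mem_linPoly δ a

end LinearizedPolynomials

end PGalois

theorem mainTheorem9 {F : Type*} [DivisionRing F] {n : ℕ}
    (σ : F →+* Matrix (Fin n) (Fin n) F) (δ : PGalois.SkewDerivation σ) (a : Fin n → F)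
    (K : Subfield F) (hK : PGalois.IsPGaloisExtension K δ a) :
    (PGalois.IsFiniteExtension K ↔ Module.Finite F (PGalois.linPoly δ a)) ∧
    (PGalois.IsFiniteExtension K →
      Module.finrank F (PGalois.linPoly δ a) = PGalois.rightDim K) ∧
    (∀ f ∈ PGalois.monOps δ a, IsLinearMap (PGalois.rightScalars K) f) ∧
    ((PGalois.monOps δ a).Finite →
      PGalois.IsFiniteExtension K ∧ PGalois.rightDim K ≤ (PGalois.monOps δ a).ncard) := by
  obtain rfl := hK.eq_centralizer
  refine ⟨PGalois.isFiniteExtension_centralizer_iff δ a, PGalois.finrank_linPoly δ a,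
    fun _ => PGalois.isLinearMap_of_mem_monOps δ a, fun hfin => ?_⟩
  have hext := (PGalois.isFiniteExtension_centralizer_iff δ a).mpr
    (Module.Finite.span_of_finite F hfin)
  refine ⟨hext, ?_⟩
  rw [← PGalois.finrank_linPoly δ a hext]
  exact PGalois.finrank_span_le_ncard hfin
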